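/- **Setting.** A source sends messages $\mathbf s_0,\mathbf s_1,\dots\in\mathbb F^{k}$ over $L_1\ge 1$ parallel links to a relay (first hop), and the relay sends packets over $L_2\ge1$ parallel links to a destination (second hop). At time $t$ the source encodes $\mathbf s_0,\dots,\mathbf s_t$ into one packet per link, the relay encodes the packets received at times $0,\dots,t$ into one packet per link, and the destination estimates $\mathbf s_t$ from what it received at times $0,\dots,t+T$. On link $i$ of hop $h$ at most $N^{(h)}_i$ packets are erased over the whole timeline (at arbitrary times). Assume $N^{(h)}_i\ge1$ and $$T\ge\max\bigl(\max_i N^{(1)}_i+\min_j N^{(2)}_j,\ \max_j N^{(2)}_j+\min_i N^{(1)}_i\bigr),$$ and let $\mathbb F$ be any field with at least $T$ elements. **Optimal spectrum.** For integers $N\ge 1$, $0\le k<n$ with $N\mid n-k$, put $w=\lceil \frac{Nn}{n-k}-1\rceil$ and let $G_{N,n,k}(d)$, the number of symbols with delay $d$, be $\frac{n-k}{N}$ for $N\le d<w$, $\;n-w\frac{n-k}{N}$ for $d=w\ge N$, and $0$ otherwise. **Parameters (OSWDF algorithm).** Choose one hop $B$ as the bottleneck; let $O$ be the other hop, and $m_B=\min_i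 N^{(B)}_i$, $m_O=\min_j N^{(O)}_j$, $D=T-m_B$. A *point of operation* is a packet length $n$ and numbers $k^{(B)}_i$ of symbols on the bottleneck links: either the initial one, $n=(T+1-m_O)(T+1-m_B)$, $k^{(B)}_i=\frac{T+1-m_O-N^{(B)}_i}{T+1-m_O}\,n$, or, in later iterations, any integers $n\ge 1$, $k_i^{(B)}\ge 0$ with $\frac{k^{(B)}_i}{n}\le\frac{T+1-m_O-N^{(B)}_i}{T+1-m_O}$ and $N^{(B)}_i\mid n-k^{(B)}_i$ for all $i$. Given a point of operation, put $c(d)=\sum_i G_{N^{(B)}_i,n,k^{(B)}_i}(T-d)$ for $0\le d\le T$ and $c(d)=0$ for $d>T$. Process the links $i$ of hop $O$ in decreasing order of $N_i^{(O)}$ (ties broken arbitrarily); for link $i$ with $N=N^{(O)}_i$: 1. set $k^{(O)}_i=\Bigl\lfloor\min_{N-1\le d\le D}\Bigl(n-nN\,\frac{1-\sum_{d<l\le D}c(l)/n}{d+1}\Bigr)\Bigr\rfloor$; 2. if $N\nmid n-k^{(O)}_i$, multiply $n$, $c$, all $k^{(B)}_l$, and all $k^{(O)}_l$ computed so far (including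 $k^{(O)}_i$) by $N$; 3. replace $c(d)$ by $c(d)-G_{N,n,k^{(O)}_i}(d)$ for all $d$ and then, for $d=0,1,2,\dots$ in turn, if $c(d)<0$, add $c(d)$ to $c(d+1)$ and set $c(d)=0$. Let $n,k^{(B)}_i,k^{(O)}_j$ be the final values and $k=\sum_j k^{(O)}_j$. **Theorem.** For either choice of the bottleneck hop, every point of operation, and every such order of the links, there is a code with these parameters, i.e. packet length $n$ on every link of both hops and $k$ source symbols per message, for which the destination recovers every $\mathbf s_t$ exactly at time $t+T$, for all messages and all admissible erasures. The code has the following structure. - *Link codes.* Link $i$ of hop $h$ carries a single-link code for $k^{(h)}_i$ symbols which, under $N^{(h)}_i$ erasures, recovers each symbol within its delay, exactly $G_{N^{(h)}_i,n,k^{(h)}_i}(d)$ of the symbols having delay $d$. Up to an ordering of message symbols and packet coordinates, it is a concatenation of diagonally interleaved systematic MDS codes with $N^{(h)}_i$ parity symbols each: in an $(m+N,m)$ block, symbol $p\in\{0,\dots,m-1\}$ of $\mathbf s_t$ is coordinate $p$ of the codeword whose $r$-th coordinate is sent at time $t-p+r$, and its delay is $m+N-1-p$. - *Separate coding.* In each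 hop the $k$ source symbols are placed injectively in the symbol positions of the links; every link encodes only its own symbols. Positions left free (they occur only in hop $B$) carry zeros, and are positions of largest delay. - *Symbol-wise decode-and-forward.* The relay decodes source symbol $j$ with its first-hop delay $T^{(1)}_j$ and uses $\mathbf s'_t[j]=\mathbf s_{t-T^{(1)}_j}[j]$ (zero for negative times) as symbol $j$ of its own message at time $t$; the destination decodes the relay's messages with delays $T^{(2)}_j$, and $T^{(1)}_j+T^{(2)}_j\le T$ for all $j$. -/

import Mathlib

/-! Streaming codes over a source - relay - destination network with several parallel erasure
links in each hop, symbol-wise decode-and-forward, separate coding, and the allocation algorithm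
of the optimized symbol-wise decode-and-forward scheme. -/

namespace MultiLinkRelay

/-! ### Erasure channels -/

/-- `e t = true` means that the packet sent at time `t` is erased; at most `N` packets are. -/
def IsErasureSequence (N : ℕ) (e : ℕ → Bool) : Prop :=
  {t | e t = true}.encard ≤ N

/-- The erasure channel: `none` is the erasure symbol. -/
def channel {α : Type*} (x : α) (e : Bool) : Option α :=
  if e = true then none else some x

/-! ### Streaming codes over the two-hop network -/

/-- An `(n₁, n₂, k, T)` streaming code over `F`: at time `t` the source encodes the messages
`s 0, …, s t`, the relay encodes the packets that it received at the times `0, …, t`, and the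
destination estimates `s t` from the packets that it received at the times `0, …, t + T`. -/
structure StreamingCode (F : Type*) {L₁ L₂ : ℕ} (n₁ : Fin L₁ → ℕ) (n₂ : Fin L₂ → ℕ)
    (k T : ℕ) where
  enc : ∀ t : ℕ, (Fin (t + 1) → Fin k → F) → ∀ i, Fin (n₁ i) → F
  relay : ∀ t : ℕ, (Fin (t + 1) → ∀ i, Option (Fin (n₁ i) → F)) → ∀ i, Fin (n₂ i) → F
  dec : ∀ t : ℕ, (Fin (t + T + 1) → ∀ i, Option (Fin (n₂ i) → F)) → Fin k → F

namespace StreamingCode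

variable {F : Type*} {L₁ L₂ : ℕ} {n₁ : Fin L₁ → ℕ} {n₂ : Fin L₂ → ℕ} {k T : ℕ}

/-- The packet received by the relay at time `t` on link `i` of the first hop. -/
def relayReceived (C : StreamingCode F n₁ n₂ k T) (s : ℕ → Fin k → F) (e₁ : Fin L₁ → ℕ → Bool)
    (t : ℕ) (i : Fin L₁) : Option (Fin (n₁ i) → F) :=
  channel (C.enc t (fun τ => s τ) i) (e₁ i t)

/-- The packet received by the destination at time `t` on link `i` of the second hop. -/
def destReceived (C : StreamingCode F n₁ n₂ k T) (s : ℕ → Fin k → F) (e₁ : Fin L₁ → ℕ → Bool)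
    (e₂ : Fin L₂ → ℕ → Bool) (t : ℕ) (i : Fin L₂) : Option (Fin (n₂ i) → F) :=
  channel (C.relay t (fun τ => C.relayReceived s e₁ τ) i) (e₂ i t)

/-- The estimate of `s t` that the destination forms at time `t + T`. -/
def estimate (C : StreamingCode F n₁ n₂ k T) (s : ℕ → Fin k → F) (e₁ : Fin L₁ → ℕ → Bool)
    (e₂ : Fin L₂ → ℕ → Bool) (t : ℕ) : Fin k → F :=
  C.dec t (fun τ => C.destReceived s e₁ e₂ τ)

/-- The destination recovers every source message with delay `T`, whatever the messages are and
whatever admissible erasures occur on the links of both hops. -/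
def IsAchievable (C : StreamingCode F n₁ n₂ k T) (N₁ : Fin L₁ → ℕ) (N₂ : Fin L₂ → ℕ) : Prop :=
  ∀ (s : ℕ → Fin k → F) (e₁ : Fin L₁ → ℕ → Bool) (e₂ : Fin L₂ → ℕ → Bool),
    (∀ i, IsErasureSequence (N₁ i) (e₁ i)) → (∀ i, IsErasureSequence (N₂ i) (e₂ i)) →
      ∀ t, C.estimate s e₁ e₂ t = s t

end StreamingCode

/-! ### Point-to-point codes and delay spectra -/

/-- A point-to-point code with links indexed by `ι` and message symbols indexed by `κ`, where
`n i` is the packet length on link `i` and `T j` the delay of the `j`-th symbol: the `j`-th symbol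
of the message of time `t` is estimated from the packets received at the times
`0, …, t + T j`. -/
structure PointToPointCode (F : Type*) {ι κ : Type} (n : ι → ℕ) (T : κ → ℕ) where
  enc : ∀ t : ℕ, (Fin (t + 1) → κ → F) → ∀ i, Fin (n i) → F
  dec : ∀ (j : κ) (t : ℕ), (Fin (t + T j + 1) → ∀ i, Option (Fin (n i) → F)) → F

/-- Single-link codes with packet length `n`. -/
abbrev SingleLinkCode (F : Type*) {κ : Type} (n : ℕ) (T : κ → ℕ) :=
  PointToPointCode F (fun _ : Unit => n) T

namespace PointToPointCode

variable {F : Type*} {ι κ : Type} {n : ι → ℕ} {T : κ → ℕ}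

def received (C : PointToPointCode F n T) (s : ℕ → κ → F) (e : ι → ℕ → Bool) (t : ℕ) (i : ι) :
    Option (Fin (n i) → F) :=
  channel (C.enc t (fun τ => s τ) i) (e i t)

/-- The code achieves its delay spectrum `T` under `N i` erasures on each link `i`. -/
def AchievesSpectrum (C : PointToPointCode F n T) (N : ι → ℕ) : Prop :=
  ∀ (s : ℕ → κ → F) (e : ι → ℕ → Bool), (∀ i, IsErasureSequence (N i) (e i)) →
    ∀ (j : κ) (t : ℕ), C.dec j t (fun τ => C.received s e τ) = s t j

/-- Separate coding: the message symbols are split among the links, and each link carries its own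
symbols by means of its own single-link code. -/
def separate {κ : ι → Type} {T : ∀ i, κ i → ℕ} (C : ∀ i, SingleLinkCode F (n i) (T i)) :
    PointToPointCode F n (fun x : Σ i, κ i => T x.1 x.2) where
  enc t s i := (C i).enc t (fun τ j => s τ ⟨i, j⟩) ()
  dec x t y := (C x.1).dec x.2 t (fun τ _ => y τ x.1)

/-- Relabeling of message symbols: symbol `j` is sent in position `p j` of the code `C`, and the
positions that are not used carry the trivial symbol `0`. -/
noncomputable def place [Zero F] {κ' : Type} (C : PointToPointCode F n T) (p : κ' ↪ κ) :
    PointToPointCode F n (fun j => T (p j)) where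
  enc t s := C.enc t (fun τ => Function.extend p (s τ) 0)
  dec j := C.dec (p j)

end PointToPointCode

/-- Symbol-wise decode-and-forward. The relay decodes symbol `j` of the source message of time `t`
at time `t + T₁ j` and uses it as symbol `j` of its own message of time `t + T₁ j`; symbols that
would refer to negative times are `0`. The destination decodes the relay's messages. -/
def symbolwiseDF {F : Type*} [Zero F] {L₁ L₂ : ℕ} {n₁ : Fin L₁ → ℕ} {n₂ : Fin L₂ → ℕ} {k : ℕ}
    {T₁ T₂ : Fin k → ℕ} (C₁ : PointToPointCode F n₁ T₁) (C₂ : PointToPointCode F n₂ T₂) (T : ℕ)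
    (hT : ∀ j, T₁ j + T₂ j ≤ T) : StreamingCode F n₁ n₂ k T where
  enc := C₁.enc
  relay t y := C₂.enc t fun τ j =>
    if h : T₁ j ≤ τ then
      C₁.dec j (τ - T₁ j) fun u => y ⟨u, by have := u.2; have := τ.2; omega⟩
    else 0
  dec t y j := C₂.dec j (t + T₁ j) fun u => y ⟨u, by have := u.2; have := hT j; omega⟩

/-! ### Diagonally interleaved MDS codes -/

/-- The systematic `(m + N, m)` block code with codewords `(u, u P)` is maximum distance separable:
its minimum distance is at least (hence exactly, if `m > 0`) `N + 1`. -/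
def IsMDS {F : Type*} [Field F] {m N : ℕ} (P : Matrix (Fin m) (Fin N) F) : Prop := by
  classical
  exact ∀ u : Fin m → F, u ≠ 0 → N + 1 ≤ hammingNorm (Sum.elim u (Matrix.vecMul u P))

/-- Diagonal interleaving of the systematic block code with parity part `P`: the codeword that
starts at time `a` occupies row `r` of the packet of time `a + r`. Thus row `p < m` at time `t`
carries `s t p`, and row `m + q` at time `t` carries the parity symbol `q` of the codeword that
starts at time `t - (m + q)`, whose information symbols are `s (t - (m + q) + p) p`
(with `0` for negative times). -/
def diagonalInterleaving {F : Type*} [Field F] {m N : ℕ} (P : Matrix (Fin m) (Fin N) F) (t : ℕ)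
    (s : Fin (t + 1) → Fin m → F) : Fin m ⊕ Fin N → F
  | Sum.inl p => s (Fin.last t) p
  | Sum.inr q => ∑ p : Fin m,
      if m + q ≤ t + p then s ⟨t + p - (m + q), by have := p.2; omega⟩ p * P p q else 0

/-- Up to an ordering of message symbols and packet coordinates, the single-link code `C` is a
concatenation of `r` diagonally interleaved systematic `(m b + N, m b)` MDS codes, `b < r`, and
symbol number `p` (counted from `0`) of such a code is decoded with delay `m b + N - 1 - p`. -/
def IsInterleavedMDSConcatenation {F : Type*} [Field F] {κ : Type} {n : ℕ} {T : κ → ℕ} (N : ℕ)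
    (C : SingleLinkCode F n T) : Prop :=
  ∃ (r : ℕ) (m : Fin r → ℕ) (P : ∀ b, Matrix (Fin (m b)) (Fin N) F)
    (σ : (Σ b, Fin (m b)) ≃ κ) (ρ : (Σ b, Fin (m b) ⊕ Fin N) ≃ Fin n),
    (∀ b, IsMDS (P b)) ∧
    (∀ b (p : Fin (m b)), T (σ ⟨b, p⟩) = m b + N - 1 - p) ∧
    ∀ (t : ℕ) (s : Fin (t + 1) → κ → F) (b : Fin r) (z : Fin (m b) ⊕ Fin N),
      C.enc t s () (ρ ⟨b, z⟩) =
        diagonalInterleaving (P b) t (fun τ p => s τ (σ ⟨b, p⟩)) z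

/-! ### The optimal delay spectrum of a single link -/

/-- The worst delay of an `(n, k)` single-link code under `N` erasures. -/
def worstDelay (N n k : ℕ) : ℕ :=
  ⌈((N : ℚ) * n / ((n : ℚ) - k) - 1 : ℚ)⌉₊

/-- The optimal delay spectrum for `N` erasures, packet length `n` and `k` symbols, as a list of
equally-delayed groups: the number of symbols with delay `d` is `(n - k) / N` for
`N ≤ d < worstDelay`, it is `n - worstDelay * (n - k) / N` for `d = worstDelay`, and `0` for all
other `d`. It is used only for `N ∣ n - k`. -/
def optimalSpectrum (N n k d : ℕ) : ℕ :=
  if d < N ∨ worstDelay N n k < d then 0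
  else if d = worstDelay N n k then n - worstDelay N n k * ((n - k) / N)
  else (n - k) / N

/-! ### The allocation algorithm

One hop is the bottleneck; `NB` and `NO` are the erasure vectors of the bottleneck and of the
other hop. -/

/-- A point of operation of the bottleneck hop: the common packet length `n` of all links, and the
number `k i` of symbols sent on link `i`. -/
structure OperatingPoint (L : ℕ) where
  n : ℕ
  k : Fin L → ℕ

/-- The starting point: `n = (T + 1 - min NO) (T + 1 - min NB)` and `k i = R i * n`, where
`R i = (T + 1 - min NO - NB i) / (T + 1 - min NO)`. -/
noncomputable def initialPoint (T : ℕ) {LB LO : ℕ} (NB : Fin LB → ℕ) (NO : Fin LO → ℕ) :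
    OperatingPoint LB where
  n := (T + 1 - ⨅ j, NO j) * (T + 1 - ⨅ i, NB i)
  k i := (T + 1 - (⨅ j, NO j) - NB i) * (T + 1 - ⨅ i, NB i)

/-- The points of operation among which the algorithm searches: the starting point, and every
point obtained by changing the rates `k i / n` of the bottleneck links, where the rate of link `i`
never exceeds `(T + 1 - min NO - NB i) / (T + 1 - min NO)` and `(n - k i) / NB i` is an
integer. -/
inductive IsPointOfOperation (T : ℕ) {LB LO : ℕ} (NB : Fin LB → ℕ) (NO : Fin LO → ℕ) :
    OperatingPoint LB → Prop
  | initial : IsPointOfOperation T NB NO (initialPoint T NB NO)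
  | adjusted (P : OperatingPoint LB) (hn : 0 < P.n)
      (hrate : ∀ i, (P.k i : ℚ) / P.n ≤
        ((T : ℚ) + 1 - (⨅ j, NO j : ℕ) - NB i) / ((T : ℚ) + 1 - (⨅ j, NO j : ℕ)))
      (hint : ∀ i, NB i ∣ P.n - P.k i) : IsPointOfOperation T NB NO P

/-- The state of the algorithm: the common packet length, the numbers of symbols allocated to the
links of the bottleneck and of the other hop, and, for each delay `d`, the number `con d` of
symbols that may still be sent with delay `d` in the other hop. -/
structure AllocState (LB LO : ℕ) where
  n : ℕ
  kB : Fin LB → ℕ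
  kO : Fin LO → ℕ
  con : ℕ → ℤ

/-- The initial constraint: as many symbols may be sent with delay `d` in the other hop as are sent
with delay `T - d` in the bottleneck. -/
def allocInit (T : ℕ) {LB LO : ℕ} (NB : Fin LB → ℕ) (P : OperatingPoint LB) :
    AllocState LB LO where
  n := P.n
  kB := P.k
  kO _ := 0
  con d := ∑ i, (optimalSpectrum (NB i) P.n (P.k i) (T - d) : ℤ)

/-- `rateCon D n con d` is the sum of `con l / n` over the delays `d < l ≤ D`. -/
def rateCon (D n : ℕ) (con : ℕ → ℤ) (d : ℕ) : ℚ :=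
  ∑ l ∈ Finset.Ioc d D, (con l : ℚ) / n

/-- The number of symbols allocated to a link with `N` erasures: the floor of the minimum of
`n - n N (1 - rateCon d) / (d + 1)` over the delays `d = D, D - 1, …, N - 1`. -/
def linkSymbols (D N n : ℕ) (con : ℕ → ℤ) : ℕ :=
  ⌊(Finset.range (D - N + 2)).inf' ⟨0, by simp⟩ fun j =>
    (n : ℚ) - n * N * ((1 - rateCon D n con (D - j)) / ((D - j : ℕ) + 1))⌋₊

/-- The (nonpositive) amount that is moved into delay `d` when negative entries of `v` are moved to
the next larger delay. -/
def carry (v : ℕ → ℤ) : ℕ → ℤ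
  | 0 => 0
  | d + 1 => min 0 (v d + carry v d)

/-- Removal of negative entries by moving them to the next larger delay. -/
def moveNegatives (v : ℕ → ℤ) (d : ℕ) : ℤ :=
  max 0 (v d + carry v d)

/-- One step of the algorithm, for link `i` of the other hop, where `D` is the largest delay
allowed: find the number `k` of symbols for this link; if `(n - k) / NO i` is not an integer,
multiply all parameters by `NO i`; subtract the optimal spectrum of this link from the constraint
and remove negative entries. -/
def allocStep (D : ℕ) {LB LO : ℕ} (NO : Fin LO → ℕ) (S : AllocState LB LO) (i : Fin LO) :
    AllocState LB LO :=
  let k := linkSymbols D (NO i) S.n S.con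
  let c := if NO i ∣ S.n - k then 1 else NO i
  { n := c * S.n
    kB := fun l => c * S.kB l
    kO := fun l => c * Function.update S.kO i k l
    con := moveNegatives fun d => c * S.con d - optimalSpectrum (NO i) (c * S.n) (c * k) d }

/-- The parameters computed from the point of operation `P` when the links of the other hop are
processed in the given order; the largest delay allowed in the other hop is `T - min NB`. -/
noncomputable def allocate (T : ℕ) {LB LO : ℕ} (NB : Fin LB → ℕ) (NO : Fin LO → ℕ)
    (P : OperatingPoint LB) (order : List (Fin LO)) : AllocState LB LO :=
  order.foldl (allocStep (T - ⨅ i, NB i) NO) (allocInit T NB P)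

/-- An enumeration of all links in decreasing order of the number of erasures. -/
def IsDecreasingOrder {L : ℕ} (N : Fin L → ℕ) (order : List (Fin L)) : Prop :=
  order.Nodup ∧ (∀ i, i ∈ order) ∧ order.Pairwise fun i j => N j ≤ N i

/-! ### The scheme -/

/-- One hop of the scheme, for `k` source symbols: packet length `n` on every link, single-link
codes for `kl i` symbols on link `i` that are concatenations of diagonally interleaved MDS codes
and achieve the optimal delay spectrum under `N i` erasures, and a placement of the source symbols
in the symbol positions of the links. If there are more positions than source symbols, the ones
left free (which carry zeros) are positions of largest delay. -/
structure HopDesign (F : Type*) [Field F] {L : ℕ} (N : Fin L → ℕ) (n k : ℕ)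
    (kl : Fin L → ℕ) where
  delay : ∀ i, Fin (kl i) → ℕ
  code : ∀ i, SingleLinkCode F n (delay i)
  position : Fin k ↪ Σ i, Fin (kl i)
  delay_card : ∀ i d, (Finset.univ.filter fun j => delay i j = d).card =
    optimalSpectrum (N i) n (kl i) d
  achieves : ∀ i, (code i).AchievesSpectrum fun _ => N i
  interleaved : ∀ i, IsInterleavedMDSConcatenation (N i) (code i)
  free_largest : ∀ x, x ∉ Set.range position →
    ∀ j, delay (position j).1 (position j).2 ≤ delay x.1 x.2

namespace HopDesign

variable {F : Type*} [Field F] {L : ℕ} {N : Fin L → ℕ} {n k : ℕ} {kl : Fin L → ℕ}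

/-- The delay of the `j`-th source symbol in this hop. -/
def symbolDelay (H : HopDesign F N n k kl) (j : Fin k) : ℕ :=
  H.delay (H.position j).1 (H.position j).2

/-- The multi-link code of the hop: separate coding on the links. -/
noncomputable def hopCode (H : HopDesign F N n k kl) :
    PointToPointCode F (fun _ : Fin L => n) H.symbolDelay :=
  (PointToPointCode.separate H.code).place H.position

end HopDesign

/-- There is a symbol-wise decode-and-forward code with separate coding on all links, with packet
length `n` on every link, `k₁ i` and `k₂ i` symbol positions on link `i` of the first and second
hop with the optimal delay spectra, and `k` source symbols per message, all of which the
destination recovers with delay `T`. -/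
def SchemeAchieves (F : Type*) [Field F] (T : ℕ) {L₁ L₂ : ℕ} (N₁ : Fin L₁ → ℕ) (N₂ : Fin L₂ → ℕ)
    (n k : ℕ) (k₁ : Fin L₁ → ℕ) (k₂ : Fin L₂ → ℕ) : Prop :=
  ∃ (H₁ : HopDesign F N₁ n k k₁) (H₂ : HopDesign F N₂ n k k₂)
    (hT : ∀ j, H₁.symbolDelay j + H₂.symbolDelay j ≤ T),
    (symbolwiseDF H₁.hopCode H₂.hopCode T hT).IsAchievable N₁ N₂

end MultiLinkRelay

namespace MultiLinkRelay

/-! ### Composition of codes -/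

/-! Since delays add along symbol-wise decode-and-forward, it suffices to build the link codes of
both hops and to pair the symbols of hop `O` with positions of hop `B` so that the two delays sum to
at most `T`.

Link codes: with `r = (n - k) / N`, write the `n` packet coordinates row by row into `r` columns.
Each column is one diagonally interleaved Reed-Solomon codeword with `N` parities, and counting the
entries of row `d` gives the optimal spectrum (`exists_linkCode`).

Pairing: sorting one side by decreasing and the other by increasing delay works as soon as, for
every `d`, the symbols of hop `O` with delay at least `d` are no more numerous than the positions of
hop `B` with delay at most `T - d` (`exists_matching`). The algorithm maintains this tail
inequality, with the tail of `con` as the remaining slack (`AllocInvariant`). The tail of the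
optimal spectrum from `d ≥ N` is at most `n - d r` (truncated at `0`), and the minimum defining
`linkSymbols` says precisely that `n - d r` fits into the tail of `con`. Moving negative entries to
larger delays does not increase any tail, and multiplying all parameters by a constant scales both
sides alike (`AllocInvariant.step`). -/

theorem symbolwiseDF_isAchievable {F : Type*} [Zero F] {L₁ L₂ : ℕ} {n₁ : Fin L₁ → ℕ}
    {n₂ : Fin L₂ → ℕ} {k : ℕ} {T₁ T₂ : Fin k → ℕ} {C₁ : PointToPointCode F n₁ T₁}
    {C₂ : PointToPointCode F n₂ T₂} {T : ℕ} (hT : ∀ j, T₁ j + T₂ j ≤ T) {N₁ : Fin L₁ → ℕ}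
    {N₂ : Fin L₂ → ℕ} (h₁ : C₁.AchievesSpectrum N₁) (h₂ : C₂.AchievesSpectrum N₂) :
    (symbolwiseDF C₁ C₂ T hT).IsAchievable N₁ N₂ := by
  intro s e₁ e₂ he₁ he₂ t
  funext j
  -- Correct first-hop decoding makes the relay's message stream the source stream with symbol `j`
  -- delayed by `T₁ j`; its symbol `j` at time `t + T₁ j` is `s t j`.
  have key := h₂ (fun τ j => if T₁ j ≤ τ then s (τ - T₁ j) j else 0) e₂ he₂ j (t + T₁ j)
  simp only [Nat.le_add_left, if_true, Nat.add_sub_cancel] at key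
  refine Eq.trans ?_ key
  change C₂.dec j (t + T₁ j) _ = C₂.dec j (t + T₁ j) _
  congr 1
  funext τ i
  change channel (C₂.enc τ _ i) _ = channel (C₂.enc τ _ i) _
  congr 2
  funext τ' j'
  by_cases h : T₁ j' ≤ τ'
  · simp only [h, dif_pos, if_true]
    exact h₁ s e₁ he₁ j' _
  · simp only [h, dif_neg, if_false, not_false_eq_true]

namespace PointToPointCode

variable {F : Type*} {ι κ : Type} {n : ι → ℕ}

theorem AchievesSpectrum.separate {κ : ι → Type} {T : ∀ i, κ i → ℕ}
    {C : ∀ i, SingleLinkCode F (n i) (T i)} {N : ι → ℕ}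
    (h : ∀ i, (C i).AchievesSpectrum fun _ => N i) :
    (PointToPointCode.separate C).AchievesSpectrum N := fun s e he x t =>
  h x.1 (fun τ j => s τ ⟨x.1, j⟩) (fun _ => e x.1) (fun _ => he x.1) x.2 t

theorem AchievesSpectrum.place [Zero F] {T : κ → ℕ} {C : PointToPointCode F n T} {N : ι → ℕ}
    (h : C.AchievesSpectrum N) {κ' : Type} (p : κ' ↪ κ) :
    (C.place p).AchievesSpectrum N := fun s e he j t =>
  (h (fun τ => Function.extend p (s τ) 0) e he (p j) t).trans
    (p.injective.extend_apply (s t) 0 j)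

/-- If the packets received in time determine each message symbol, then there is a decoder. -/
theorem exists_dec [Nonempty F] {T : κ → ℕ} {N : ι → ℕ}
    (enc : ∀ t : ℕ, (Fin (t + 1) → κ → F) → ∀ i, Fin (n i) → F)
    (h : ∀ (s s' : ℕ → κ → F) (e e' : ι → ℕ → Bool), (∀ i, IsErasureSequence (N i) (e i)) →
      ∀ (j : κ) (t : ℕ), (∀ τ ≤ t + T j, ∀ i, channel (enc τ (fun a => s a) i) (e i τ) =
        channel (enc τ (fun a => s' a) i) (e' i τ)) → s t j = s' t j) :
    ∃ C : PointToPointCode F n T, C.enc = enc ∧ C.AchievesSpectrum N := by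
  classical
  let good (j : κ) (t : ℕ) (y : Fin (t + T j + 1) → ∀ i, Option (Fin (n i) → F))
      (x : (ℕ → κ → F) × (ι → ℕ → Bool)) : Prop :=
    (∀ i, IsErasureSequence (N i) (x.2 i)) ∧
      y = fun (τ : Fin (t + T j + 1)) i => channel (enc τ (fun a => x.1 a) i) (x.2 i τ)
  -- The decoder answers according to any admissible pair of messages and erasures that explains the
  -- received packets. The true pair is one, so the default value is never used on actual
  -- receptions.
  refine ⟨⟨enc, fun j t y => if hy : ∃ x, good j t y x then hy.choose.1 t j
    else Classical.arbitrary F⟩, rfl, ?_⟩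
  intro s e he j t
  have hy : ∃ x, good j t (fun (τ : Fin (t + T j + 1)) i => channel (enc τ (fun a => s a) i) (e i τ)) x :=
    ⟨(s, e), he, rfl⟩
  refine (dif_pos hy).trans ?_
  have hc := hy.choose_spec
  refine h _ _ _ e hc.1 j t fun τ hτ i => ?_
  exact (congrFun (congrFun hc.2 ⟨τ, by omega⟩) i).symm

end PointToPointCode

theorem HopDesign.hopCode_achieves {F : Type*} [Field F] {L : ℕ} {N : Fin L → ℕ} {n k : ℕ}
    {kl : Fin L → ℕ} (H : HopDesign F N n k kl) : H.hopCode.AchievesSpectrum N :=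
  (PointToPointCode.AchievesSpectrum.separate H.achieves).place H.position

/-! ### Systematic Reed-Solomon codes -/

theorem exists_embedding_of_card_le {α F : Type*} [Fintype α]
    (h : (Fintype.card α : ℕ∞) ≤ ENat.card F) : Nonempty (α ↪ F) := by
  rcases finite_or_infinite F with hF | hF
  · have := Fintype.ofFinite F
    rw [ENat.card_eq_coe_fintype_card] at h
    exact Function.Embedding.nonempty_of_card_le (by exact_mod_cast h)
  · exact ⟨(Fintype.equivFin α).toEmbedding.trans
      (Fin.valEmbedding.trans (Infinite.natEmbedding F))⟩

/-- Systematic Reed-Solomon code: interpolate `u` at `m` points by a polynomial of degree less than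
`m`, and take its values at `N` further points as parities. A codeword of weight at most `N` has at
least `m` zeros, so its polynomial vanishes. -/
theorem exists_isMDS {F : Type*} [Field F] (m N : ℕ) (h : ((m + N : ℕ) : ℕ∞) ≤ ENat.card F) :
    ∃ P : Matrix (Fin m) (Fin N) F, IsMDS P := by
  classical
  obtain ⟨a⟩ := exists_embedding_of_card_le (α := Fin m ⊕ Fin N) (F := F) (by simpa using h)
  have ha : Set.InjOn (fun p => a (Sum.inl p)) (Finset.univ : Finset (Fin m)) :=
    fun _ _ _ _ h => Sum.inl_injective (a.injective h)
  refine ⟨fun p q => (Lagrange.basis Finset.univ (fun p => a (Sum.inl p)) p).eval (a (Sum.inr q)),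
    ?_⟩
  intro u hu
  set f := Lagrange.interpolate Finset.univ (fun p => a (Sum.inl p)) u with hf
  by_contra hlt
  have heval : ∀ z, Sum.elim u (Matrix.vecMul u fun p q =>
      (Lagrange.basis Finset.univ (fun p => a (Sum.inl p)) p).eval (a (Sum.inr q))) z =
      f.eval (a z) := by
    rintro (p | q)
    · exact (Lagrange.eval_interpolate_at_node u ha (Finset.mem_univ p)).symm
    · simp [hf, Lagrange.interpolate_apply, Matrix.vecMul, dotProduct, Polynomial.eval_finsetSum]
  have hz : f = 0 := by
    refine Polynomial.eq_zero_of_degree_lt_of_eval_index_eq_zero (v := a)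
      (Finset.univ.filter fun z => f.eval (a z) = 0) a.injective.injOn ?_ (by simp)
    refine (Lagrange.degree_interpolate_lt u ha).trans_le ?_
    have h1 := Finset.card_filter_add_card_filter_not (s := (Finset.univ : Finset (Fin m ⊕ Fin N)))
      (fun z => f.eval (a z) = 0)
    have h2 : (Finset.univ.filter fun z => ¬ f.eval (a z) = 0).card ≤ N := by
      rw [not_le, Nat.lt_succ_iff] at hlt
      refine le_trans (le_of_eq ?_) hlt
      unfold hammingNorm
      congr 1
      ext z
      simp only [Finset.mem_filter, Finset.mem_univ, true_and, heval]
    simp only [Finset.card_univ, Fintype.card_sum, Fintype.card_fin] at h1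
    simp only [Finset.card_univ, Fintype.card_fin]
    exact_mod_cast (by omega : m ≤ _)
  refine hu (funext fun p => ?_)
  have := heval (Sum.inl p)
  simpa [hz] using this

/-! ### Diagonal interleaving -/

/-- A symbol of a diagonally interleaved MDS code is determined by the unerased packets up to the
end of its codeword. -/
theorem diagonalInterleaving_unique {F : Type*} [Field F] {m N : ℕ}
    {P : Matrix (Fin m) (Fin N) F} (hP : IsMDS P) (s s' : ℕ → Fin m → F) (e : ℕ → Bool)
    (he : IsErasureSequence N e) (t : ℕ) (p : Fin m)
    (h : ∀ τ ≤ t + (m + N - 1 - p), e τ = false →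
      ∀ z, diagonalInterleaving P τ (fun a => s a) z =
        diagonalInterleaving P τ (fun a => s' a) z) :
    s t p = s' t p := by
  classical
  have hp := p.2
  -- Difference of the two information words on the diagonal through symbol `p` of time `t`; that
  -- codeword starts at time `t - p`, which may be negative.
  let u : Fin m → F := fun p' =>
    if (p : ℕ) ≤ t + p' then s (t + p' - p) p' - s' (t + p' - p) p' else 0
  let row : Fin m ⊕ Fin N → ℕ := Sum.elim (fun p' => p') (fun q => m + q)
  have hrow : Function.Injective row := by
    rintro (x | x) (y | y) hxy <;> simp only [row, Sum.elim_inl, Sum.elim_inr] at hxy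
    · rw [Fin.ext hxy]
    · have := x.2; omega
    · have := y.2; omega
    · rw [Fin.ext (Nat.add_left_cancel hxy)]
  have hrow_lt : ∀ z, row z < m + N := by
    rintro (x | x) <;> simp only [row, Sum.elim_inl, Sum.elim_inr] <;> have := x.2 <;> omega
  -- Every nonzero coordinate of the difference codeword is sent at an erased, nonnegative time.
  -- Distinct rows have distinct times, so the weight is at most `N`, below the minimum distance.
  have hcode : ∀ z, Sum.elim u (Matrix.vecMul u P) z ≠ 0 →
      (p : ℕ) ≤ t + row z ∧ e (t + row z - p) = true := by
    intro z hz
    have hle : (p : ℕ) ≤ t + row z := by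
      rcases z with p' | q
      · by_contra hlt
        exact hz (if_neg hlt)
      · simp only [row, Sum.elim_inr]; omega
    refine ⟨hle, ?_⟩
    by_contra hne
    rw [Bool.not_eq_true] at hne
    have heq := h _ (by have := hrow_lt z; omega) hne z
    refine hz ?_
    rcases z with p' | q
    · simp only [row, Sum.elim_inl] at hle heq
      simp only [Sum.elim_inl, u, if_pos hle]
      exact sub_eq_zero.2 heq
    · simp only [Sum.elim_inr, Matrix.vecMul, dotProduct]
      simp only [row, Sum.elim_inr, diagonalInterleaving] at heq
      rw [← sub_eq_zero, ← Finset.sum_sub_distrib] at heq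
      rw [← heq]
      refine Finset.sum_congr rfl fun p' _ => ?_
      by_cases hc : (p : ℕ) ≤ t + p'
      · have hc' : m + (q : ℕ) ≤ t + (m + q) - p + p' := by omega
        have ht : t + (m + (q : ℕ)) - p + p' - (m + q) = t + p' - p := by omega
        simp only [u, if_pos hc, if_pos hc', ht, sub_mul]
      · have hc' : ¬ m + (q : ℕ) ≤ t + (m + q) - p + p' := by omega
        have hup : u p' = 0 := if_neg hc
        rw [hup, zero_mul]
        exact ((congrArg₂ (· - ·) (if_neg hc') (if_neg hc')).trans (sub_zero 0)).symm
  have hu : u = 0 := by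
    by_contra hu
    have h1 := hP u hu
    have h2 : ((Finset.univ.filter fun z => Sum.elim u (Matrix.vecMul u P) z ≠ 0).card : ℕ∞)
        ≤ N := by
      refine le_trans ?_ he
      rw [← Set.encard_coe_eq_coe_finsetCard]
      refine Set.encard_le_encard_of_injOn (f := fun z => t + row z - p) ?_ ?_
      · intro z hz
        exact (hcode z (by simpa using hz)).2
      · intro x hx y hy hxy
        have h3 := (hcode x (by simpa using hx)).1
        have h4 := (hcode y (by simpa using hy)).1
        simp only at hxy
        exact hrow (by omega)
    have h3 : (Finset.univ.filter fun z => Sum.elim u (Matrix.vecMul u P) z ≠ 0).card ≤ N := by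
      exact_mod_cast h2
    have h4 : hammingNorm (Sum.elim u (Matrix.vecMul u P)) ≤ N := h3
    refine absurd h1 (not_le.2 (Nat.lt_succ_of_le (le_trans (le_of_eq ?_) h4)))
    unfold hammingNorm
    congr
  have := congrFun hu p
  simpa [u, sub_eq_zero] using this

/-! ### The optimal spectrum and link codes that achieve it -/

/-- Packet length `n` and number of symbols `k` of a single-link code for `N` erasures all of
whose codewords span at most `M` time slots. -/
structure IsLinkParameter (M N n k : ℕ) : Prop where
  lt : k < n
  dvd : N ∣ n - k
  le : N * n ≤ M * (n - k)

theorem IsLinkParameter.mul {M N n k : ℕ} (h : IsLinkParameter M N n k) {c : ℕ} (hc : 0 < c) :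
    IsLinkParameter M N (c * n) (c * k) where
  lt := Nat.mul_lt_mul_of_pos_left h.lt hc
  dvd := by rw [← Nat.mul_sub]; exact h.dvd.mul_left c
  le := by
    rw [← Nat.mul_sub]
    calc N * (c * n) = c * (N * n) := by ring
      _ ≤ c * (M * (n - k)) := Nat.mul_le_mul_left c h.le
      _ = M * (c * (n - k)) := by ring

/-- Here `r` is the number of interleaved codewords: each has `N` parities, and `n ≤ M * r` bounds
their lengths by `M`. -/
theorem IsLinkParameter.exists_eq {M N n k : ℕ} (h : IsLinkParameter M N n k) (hN : 0 < N) :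
    ∃ r, 0 < r ∧ (n - k) / N = r ∧ n = k + N * r ∧ n ≤ M * r := by
  obtain ⟨r, hr⟩ := h.dvd
  have hlt := h.lt
  refine ⟨r, Nat.pos_of_ne_zero ?_, by rw [hr, Nat.mul_div_cancel_left _ hN], by omega, ?_⟩
  · rintro rfl
    omega
  · have := h.le
    rw [hr] at this
    exact Nat.le_of_mul_le_mul_left (by linarith [Nat.mul_left_comm M N r]) hN

/-- Since `n - k = N * r`, the worst delay is `⌈n / r⌉ - 1`. -/
theorem worstDelay_bounds {N n k r : ℕ} (hN : 0 < N) (hr : 0 < r) (hn : n = k + N * r) :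
    worstDelay N n k * r < n ∧ n ≤ (worstDelay N n k + 1) * r := by
  have hrq : (0 : ℚ) < r := by exact_mod_cast hr
  have hNq : (1 : ℚ) ≤ N := by exact_mod_cast hN
  have hval : ((N : ℚ) * n / ((n : ℚ) - k) - 1 : ℚ) = n / r - 1 := by
    have : (n : ℚ) - k = N * r := by rw [hn]; push_cast; ring
    rw [this, mul_div_mul_left _ _ (by positivity)]
  unfold worstDelay
  rw [hval]
  have hnonneg : (0 : ℚ) ≤ n / r - 1 := by
    rw [sub_nonneg, one_le_div hrq, hn]
    push_cast
    nlinarith [(Nat.cast_nonneg k : (0 : ℚ) ≤ k)]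
  constructor
  · have := Nat.ceil_lt_add_one hnonneg
    rw [sub_add_cancel, lt_div_iff₀ hrq] at this
    exact_mod_cast this
  · have := Nat.le_ceil ((n : ℚ) / r - 1)
    rw [sub_le_iff_le_add, div_le_iff₀ hrq] at this
    exact_mod_cast this

/-- When `n` entries are arranged in rows of length `r`, row `d` has `min r (n - d * r)` entries.
Truncated subtraction covers the delays beyond the worst one. -/
theorem optimalSpectrum_eq {M N n k : ℕ} (h : IsLinkParameter M N n k) (hN : 0 < N) (d : ℕ) :
    optimalSpectrum N n k d =
      if d < N then 0 else min ((n - k) / N) (n - d * ((n - k) / N)) := by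
  obtain ⟨r, hr, hdiv, hn, -⟩ := h.exists_eq hN
  obtain ⟨h1, h2⟩ := worstDelay_bounds hN hr hn
  unfold optimalSpectrum
  rw [hdiv]
  generalize worstDelay N n k = w at h1 h2
  by_cases hd : d < N
  · simp [hd]
  simp only [hd, false_or, if_false]
  rcases lt_trichotomy w d with hwd | rfl | hwd
  · have : (w + 1) * r ≤ d * r := Nat.mul_le_mul_right r hwd
    rw [if_pos hwd, Nat.sub_eq_zero_of_le (h2.trans this), Nat.min_zero]
  · rw [if_neg (lt_irrefl _), if_pos rfl, min_eq_right]
    rw [add_mul, one_mul] at h2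
    omega
  · have : (d + 1) * r ≤ w * r := Nat.mul_le_mul_right r hwd
    rw [add_mul, one_mul] at this
    rw [if_neg hwd.not_gt, if_neg hwd.ne, min_eq_left]
    omega

theorem optimalSpectrum_mul {M N n k : ℕ} (h : IsLinkParameter M N n k) (hN : 0 < N) {c : ℕ}
    (hc : 0 < c) (d : ℕ) :
    optimalSpectrum N (c * n) (c * k) d = c * optimalSpectrum N n k d := by
  rw [optimalSpectrum_eq h hN, optimalSpectrum_eq (h.mul hc) hN, ← Nat.mul_sub,
    Nat.mul_div_assoc _ h.dvd]
  split_ifs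
  · simp
  · rw [Nat.mul_left_comm d, ← Nat.mul_sub, Nat.mul_min_mul_left]

theorem optimalSpectrum_eq_zero {M N n k : ℕ} (h : IsLinkParameter M N n k) (hN : 0 < N) {d : ℕ}
    (hd : d < N ∨ M ≤ d) : optimalSpectrum N n k d = 0 := by
  rw [optimalSpectrum_eq h hN]
  obtain ⟨r, hr, hdiv, hn, hM⟩ := h.exists_eq hN
  rw [hdiv]
  rcases hd with hd | hd
  · rw [if_pos hd]
  · have : M * r ≤ d * r := Nat.mul_le_mul_right r hd
    rw [Nat.sub_eq_zero_of_le (hM.trans this), Nat.min_zero, ite_self]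

/-- The number of symbols with delay at least `d ≥ N` is at most `n - d (n - k) / N`. -/
theorem sum_Ico_optimalSpectrum_le {M N n k : ℕ} (h : IsLinkParameter M N n k) (hN : 0 < N)
    {d e : ℕ} (hd : N ≤ d) :
    ∑ l ∈ Finset.Ico d e, optimalSpectrum N n k l ≤ n - d * ((n - k) / N) := by
  suffices H : ∀ e, d ≤ e → ∑ l ∈ Finset.Ico d e, optimalSpectrum N n k l +
      (n - e * ((n - k) / N)) = n - d * ((n - k) / N) by
    rcases le_or_gt d e with hde | hde
    · rw [← H e hde]
      exact Nat.le_add_right _ _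
    · simp [Finset.Ico_eq_empty_of_le hde.le]
  intro e hde
  induction e, hde using Nat.le_induction with
  | base => simp
  | succ e hde ih =>
    -- The sum telescopes: `min r (n - e * r)` is the drop from `n - e * r` to `n - (e + 1) * r` in
    -- truncated subtraction.
    rw [Finset.sum_Ico_succ_top hde, ← ih, optimalSpectrum_eq h hN, if_neg (by omega), add_mul,
      one_mul]
    generalize (n - k) / N = r
    omega

theorem exists_linkCode (F : Type*) [Field F] {M N n k : ℕ} (h : IsLinkParameter M N n k)
    (hN : 0 < N) (hM : (M : ℕ∞) ≤ ENat.card F) :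
    ∃ (delay : Fin k → ℕ) (code : SingleLinkCode F n delay),
      (∀ d, (Finset.univ.filter fun j => delay j = d).card = optimalSpectrum N n k d) ∧
      code.AchievesSpectrum (fun _ => N) ∧ IsInterleavedMDSConcatenation N code := by
  classical
  obtain ⟨r, hr, hdiv, hn, hMr⟩ := h.exists_eq hN
  -- Column `b` consists of the entries `d * r + b < n`; its height is the codeword length `m b +
  -- N`. It is at least `N` because `n ≥ N * r`.
  have hlen : ∀ b, ∃ m, b < r → ∀ d, d < m + N ↔ d * r + b < n := by
    intro b
    refine ⟨(n - 1 - b) / r + 1 - N, fun hb d => ?_⟩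
    have hNr : (N - 1) * r + r = N * r := by
      rw [← Nat.succ_mul, Nat.succ_eq_add_one, Nat.sub_add_cancel hN]
    have h1 : N - 1 ≤ (n - 1 - b) / r := (Nat.le_div_iff_mul_le hr).2 (by omega)
    have h2 : d < (n - 1 - b) / r + 1 - N + N ↔ d ≤ (n - 1 - b) / r := by omega
    rw [h2, Nat.le_div_iff_mul_le hr]
    have : 0 < N * r := Nat.mul_pos hN hr
    omega
  choose m hm using hlen
  have hmM : ∀ b < r, m b + N ≤ M := by
    intro b hb
    by_contra hlt
    have := (hm b hb M).1 (by omega)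
    omega
  choose P hP using fun b : Fin r => exists_isMDS (F := F) (m b) N
    (le_trans (by exact_mod_cast hmM b b.2) hM)
  -- Removing `N` full rows leaves `n - N * r = k` entries, so `p * r + b` enumerates the message
  -- symbols by quotient and remainder modulo `r`.
  let σ : (Σ b : Fin r, Fin (m b)) ≃ Fin k :=
    { toFun := fun x => ⟨x.2 * r + x.1, by
        have h1 := (hm x.1 x.1.2 (x.2 + N)).1 (by have := x.2.2; omega)
        rw [add_mul] at h1
        omega⟩
      invFun := fun x => ⟨⟨x % r, Nat.mod_lt _ hr⟩, ⟨x / r, by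
        have h1 := (hm (x % r) (Nat.mod_lt _ hr) (x / r + N)).2 (by
          have := Nat.div_add_mod' (x : ℕ) r
          have := x.2
          rw [add_mul]
          omega)
        change (x : ℕ) / r < m (x % r)
        exact Nat.lt_of_add_lt_add_right h1⟩⟩
      left_inv := by
        rintro ⟨b, p⟩
        have hb : ((p : ℕ) * r + b) % r = b := by
          rw [Nat.mul_comm, Nat.mul_add_mod, Nat.mod_eq_of_lt b.2]
        have hp : ((p : ℕ) * r + b) / r = p := by
          rw [Nat.add_div_of_dvd_right (Dvd.intro_left _ rfl), Nat.mul_div_cancel _ hr,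
            Nat.div_eq_of_lt b.2, add_zero]
        refine Sigma.ext (Fin.ext hb) ?_
        refine (Fin.heq_ext_iff (by simp [hb])).2 hp
      right_inv := fun x => Fin.ext (Nat.div_add_mod' (x : ℕ) r) }
  have hcard : Fintype.card (Σ b : Fin r, Fin (m b) ⊕ Fin N) = n := by
    have := Fintype.card_congr σ
    simp only [Fintype.card_sigma, Fintype.card_fin] at this
    simp only [Fintype.card_sigma, Fintype.card_sum, Fintype.card_fin, Finset.sum_add_distrib,
      this, Finset.sum_const, Finset.card_univ, smul_eq_mul]
    rw [hn, Nat.mul_comm r]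
  let ρ := Fintype.equivFinOfCardEq hcard
  let delay : Fin k → ℕ := fun j => m (σ.symm j).1 + N - 1 - (σ.symm j).2
  let enc : ∀ t : ℕ, (Fin (t + 1) → Fin k → F) → ∀ _ : Unit, Fin n → F := fun t s _ x =>
    diagonalInterleaving (P (ρ.symm x).1) t (fun τ p => s τ (σ ⟨(ρ.symm x).1, p⟩)) (ρ.symm x).2
  have hdelay : ∀ (b : Fin r) (p : Fin (m b)), delay (σ ⟨b, p⟩) = m b + N - 1 - p := fun b p =>
    congrArg (fun x : Σ b : Fin r, Fin (m b) => m x.1 + N - 1 - x.2) (σ.symm_apply_apply ⟨b, p⟩)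
  have henc : ∀ (t : ℕ) (s : Fin (t + 1) → Fin k → F) (b : Fin r) (z : Fin (m b) ⊕ Fin N),
      enc t s () (ρ ⟨b, z⟩) = diagonalInterleaving (P b) t (fun τ p => s τ (σ ⟨b, p⟩)) z :=
    fun t s b z => congrArg (fun x : Σ b : Fin r, Fin (m b) ⊕ Fin N =>
      diagonalInterleaving (P x.1) t (fun τ p => s τ (σ ⟨x.1, p⟩)) x.2)
      (ρ.symm_apply_apply ⟨b, z⟩)
  obtain ⟨code, hcode, hach⟩ := PointToPointCode.exists_dec (T := delay) (N := fun _ => N) enc (by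
    intro s s' e e' he j t heq
    obtain ⟨⟨b, p⟩, rfl⟩ := σ.surjective j
    refine diagonalInterleaving_unique (hP b) (fun τ p => s τ (σ ⟨b, p⟩))
      (fun τ p => s' τ (σ ⟨b, p⟩)) (e ()) (he ()) t p fun τ hτ hne z => ?_
    have h1 := heq τ (by rwa [hdelay]) ()
    simp only [channel, hne, Bool.false_eq_true, if_false] at h1
    split_ifs at h1
    have h2 := congrFun (Option.some.inj h1) (ρ ⟨b, z⟩)
    rwa [henc, henc] at h2)
  refine ⟨delay, code, fun d => ?_, hach, r, fun b => m b, P, σ, ρ, hP, hdelay, ?_⟩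
  · rw [optimalSpectrum_eq h hN, hdiv]
    have h1 : (Finset.univ.filter fun j => delay j = d).card =
        (Finset.univ.filter fun x : Σ b : Fin r, Fin (m b) =>
          m x.1 + N - 1 - x.2 = d).card := by
      refine Finset.card_equiv σ.symm fun j => ?_
      simp [delay]
    rw [h1]
    by_cases hd : d < N
    · rw [if_pos hd, Finset.card_eq_zero, Finset.filter_eq_empty_iff]
      intro x _
      have := x.2.2
      omega
    · rw [if_neg hd]
      -- For `d ≥ N`, column `b` has a symbol of delay `d`, and then just one, exactly when `d * r +
      -- b < n`.
      have h2 : (Finset.univ.filter fun x : Σ b : Fin r, Fin (m b) =>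
          m x.1 + N - 1 - x.2 = d).card = (Finset.range (min r (n - d * r))).card := by
        refine Finset.card_bij (fun x _ => (x.1 : ℕ)) ?_ ?_ ?_
        · rintro ⟨b, p⟩ hx
          simp only [Finset.mem_filter, Finset.mem_univ, true_and] at hx
          have hp := p.2
          have := (hm b b.2 d).1 (by omega)
          have := b.2
          simp only [Finset.mem_range]
          omega
        · rintro ⟨b, p⟩ hx ⟨b', p'⟩ hx' hbb
          obtain rfl : b = b' := Fin.ext hbb
          simp only [Finset.mem_filter, Finset.mem_univ, true_and] at hx hx'
          have hp := p.2
          have hp' := p'.2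
          have : p = p' := Fin.ext (by omega)
          rw [this]
        · intro b hb
          rw [Finset.mem_range] at hb
          have hbr : b < r := by omega
          have := (hm b hbr d).2 (by omega)
          refine ⟨⟨⟨b, hbr⟩, ⟨m b + N - 1 - d, by simp only; omega⟩⟩, ?_, rfl⟩
          simp only [Finset.mem_filter, Finset.mem_univ, true_and]
          omega
      rw [h2, Finset.card_range]
  · intro t s b z
    rw [hcode]
    exact henc t s b z

/-! ### The allocation algorithm -/

/-- Conservation at one delay: what stays plus what is passed on equals what was there plus what
arrived. -/
theorem moveNegatives_add_carry (v : ℕ → ℤ) (d : ℕ) :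
    moveNegatives v d + carry v (d + 1) = v d + carry v d := by
  rw [moveNegatives, carry, add_comm, min_add_max, zero_add]

theorem carry_nonpos (v : ℕ → ℤ) : ∀ d, carry v d ≤ 0
  | 0 => le_rfl
  | _ + 1 => min_le_left _ _

/-- If all tail sums of `v` are nonnegative, then moving negative entries does not increase
them. -/
theorem sum_Ico_moveNegatives_le {v : ℕ → ℤ} {e : ℕ} (hv : ∀ d, 0 ≤ ∑ l ∈ Finset.Ico d e, v l)
    (d : ℕ) : ∑ l ∈ Finset.Ico d e, moveNegatives v l ≤ ∑ l ∈ Finset.Ico d e, v l := by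
  -- The remaining tail can always absorb the incoming deficit; at `d = e` this says that no deficit
  -- leaves the window.
  have hcarry : ∀ d ≤ e, 0 ≤ carry v d + ∑ l ∈ Finset.Ico d e, v l := by
    intro d
    induction d with
    | zero => intro _; simpa [carry] using hv 0
    | succ d ih =>
      intro hd
      have h1 := ih (by omega)
      rw [Finset.sum_eq_sum_Ico_succ_bot (by omega)] at h1
      have h2 := hv (d + 1)
      rw [carry]
      rcases min_cases 0 (v d + carry v d) with ⟨h, -⟩ | ⟨h, -⟩ <;> rw [h] <;> linarith
  have hsum : ∀ e, d ≤ e → ∑ l ∈ Finset.Ico d e, moveNegatives v l + carry v e =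
      ∑ l ∈ Finset.Ico d e, v l + carry v d := by
    intro e hde
    induction e, hde using Nat.le_induction with
    | base => simp
    | succ e hde ih =>
      rw [Finset.sum_Ico_succ_top hde, Finset.sum_Ico_succ_top hde]
      linarith [moveNegatives_add_carry v e]
  rcases le_or_gt d e with hde | hde
  · have h1 := hcarry e le_rfl
    rw [Finset.Ico_self, Finset.sum_empty, add_zero] at h1
    linarith [hsum e hde, carry_nonpos v d]
  · simp [Finset.Ico_eq_empty_of_le hde.le]

/-- This is the algorithm's minimum at delay `e - 1`, cleared of denominators. With `n - k = N * r`
it reads `n - e * r ≤ ∑ con` over the tail from `e`. -/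
theorem linkSymbols_le {D N n : ℕ} {con : ℕ → ℤ} (hN : 0 < N) (hND : N ≤ D) (hn : 0 < n)
    (hcon : ∀ d, 0 ≤ con d) {e : ℕ} (hNe : N ≤ e) (heD : e ≤ D + 1) :
    (N : ℤ) * n ≤ e * ((n : ℤ) - linkSymbols D N n con) +
      N * ∑ l ∈ Finset.Ico e (D + 1), con l := by
  have hnq : (0 : ℚ) < n := by exact_mod_cast hn
  have hrate : ∀ d, rateCon D n con d =
      ((∑ l ∈ Finset.Ico (d + 1) (D + 1), con l : ℤ) : ℚ) / n := by
    intro d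
    rw [rateCon, Int.cast_sum, Finset.sum_div]
    exact Finset.sum_congr (by ext l; simp only [Finset.mem_Ioc, Finset.mem_Ico]; omega)
      fun _ _ => rfl
  -- A natural floor lies below its argument only if that is nonnegative, which follows from `con ≥
  -- 0` and `N ≤ d + 1`.
  have hfloor : (linkSymbols D N n con : ℚ) ≤ _ := Nat.floor_le (Finset.le_inf' _ _ (by
    intro j hj
    rw [Finset.mem_range] at hj
    have hrn : 0 ≤ rateCon D n con (D - j) := by
      rw [hrate]
      exact div_nonneg (by exact_mod_cast Finset.sum_nonneg fun l _ => hcon l) hnq.le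
    have hNq : (N : ℚ) ≤ (D - j : ℕ) + 1 := by exact_mod_cast (by omega : N ≤ D - j + 1)
    have hNp : (0 : ℚ) < N := by exact_mod_cast hN
    have h1 : (N : ℚ) * ((1 - rateCon D n con (D - j)) / ((D - j : ℕ) + 1)) ≤ 1 := by
      rw [← mul_div_assoc, div_le_one (hNp.trans_le hNq)]
      nlinarith
    rw [sub_nonneg, mul_assoc]
    nlinarith))
  have h2 := hfloor.trans (Finset.inf'_le _ (Finset.mem_range.2 (by omega : D + 1 - e < D - N + 2)))
  have he : D - (D + 1 - e) + 1 = e := by omega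
  have heq : ((D - (D + 1 - e) : ℕ) : ℚ) + 1 = e := by exact_mod_cast he
  have hep : (0 : ℚ) < e := by exact_mod_cast hN.trans_le hNe
  rw [hrate, heq, he] at h2
  generalize ∑ l ∈ Finset.Ico e (D + 1), con l = t at h2 ⊢
  have h3 : (n : ℚ) * N * ((1 - (t : ℚ) / n) / e) = N * (n - t) / e := by
    field_simp
  rw [h3, le_sub_comm, div_le_iff₀ hep] at h2
  have h4 : (N : ℚ) * n ≤ e * (n - linkSymbols D N n con) + N * t := by linarith
  exact_mod_cast h4

/-- For `d ≥ N` the bound `n - d * r` on the spectrum's tail is compared with `hk` divided by `N`.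
Below `N` the spectrum is zero while `con` is nonnegative. -/
theorem sum_Ico_optimalSpectrum_le_con {D N n k : ℕ} {con : ℕ → ℤ}
    (h : IsLinkParameter (D + 1) N n k) (hN : 0 < N) (hND : N ≤ D) (hcon : ∀ d, 0 ≤ con d)
    (hk : ∀ e, N ≤ e → e ≤ D + 1 → (N : ℤ) * n ≤ e * ((n : ℤ) - k) +
      N * ∑ l ∈ Finset.Ico e (D + 1), con l) (d : ℕ) :
    ∑ l ∈ Finset.Ico d (D + 1), (optimalSpectrum N n k l : ℤ) ≤
      ∑ l ∈ Finset.Ico d (D + 1), con l := by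
  have hlarge : ∀ d, N ≤ d → ∑ l ∈ Finset.Ico d (D + 1), (optimalSpectrum N n k l : ℤ) ≤
      ∑ l ∈ Finset.Ico d (D + 1), con l := by
    intro d hd
    rcases le_or_gt d (D + 1) with hdD | hdD
    · have h1 := hk d hd hdD
      have h2 := sum_Ico_optimalSpectrum_le h hN (e := D + 1) hd
      obtain ⟨r, hr, hdiv, hn, -⟩ := h.exists_eq hN
      rw [hdiv] at h2
      have h3 : (0 : ℤ) ≤ ∑ l ∈ Finset.Ico d (D + 1), con l :=
        Finset.sum_nonneg fun l _ => hcon l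
      have h4 : ((n : ℤ) - k) = N * r := by rw [hn]; push_cast; ring
      have h5 : (n : ℤ) ≤ d * r + ∑ l ∈ Finset.Ico d (D + 1), con l := by
        rw [h4] at h1
        refine le_of_mul_le_mul_left ?_ (by exact_mod_cast hN : (0 : ℤ) < N)
        linarith [mul_left_comm (d : ℤ) N r]
      rw [← Nat.cast_sum]
      generalize ∑ l ∈ Finset.Ico d (D + 1), optimalSpectrum N n k l = x at h2 ⊢
      have h6 : ((d * r : ℕ) : ℤ) = d * r := by push_cast; rfl
      omega
    · simp [Finset.Ico_eq_empty_of_le hdD.le]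
  rcases le_or_gt N d with hd | hd
  · exact hlarge d hd
  · rw [← Finset.sum_Ico_consecutive _ hd.le (by omega : N ≤ D + 1),
      ← Finset.sum_Ico_consecutive con hd.le (by omega : N ≤ D + 1)]
    refine add_le_add ?_ (hlarge N le_rfl)
    refine Finset.sum_le_sum fun l hl => ?_
    rw [optimalSpectrum_eq_zero h hN (Or.inl (Finset.mem_Ico.1 hl).2)]
    exact hcon l

/-- The invariant of the allocation algorithm after the links in `done` have been processed. -/
structure AllocInvariant (T D M : ℕ) {LB LO : ℕ} (NB : Fin LB → ℕ) (NO : Fin LO → ℕ)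
    (done : Finset (Fin LO)) (S : AllocState LB LO) : Prop where
  n_pos : 0 < S.n
  bottleneck : ∀ i, IsLinkParameter M (NB i) S.n (S.kB i)
  other : ∀ i ∈ done, IsLinkParameter (D + 1) (NO i) S.n (S.kO i)
  con_nonneg : ∀ d, 0 ≤ S.con d
  sum_le : ∀ d, ∑ l ∈ Finset.Ico d (D + 1), S.con l +
    ∑ i ∈ done, ∑ l ∈ Finset.Ico d (D + 1), (optimalSpectrum (NO i) S.n (S.kO i) l : ℤ) ≤
      ∑ l ∈ Finset.Ico d (D + 1), ∑ i, (optimalSpectrum (NB i) S.n (S.kB i) (T - l) : ℤ)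

theorem AllocInvariant.step {T D M LB LO : ℕ} {NB : Fin LB → ℕ} {NO : Fin LO → ℕ}
    {done : Finset (Fin LO)} {S : AllocState LB LO} (h : AllocInvariant T D M NB NO done S)
    (hNB : ∀ i, 0 < NB i) (hNO : ∀ i, 0 < NO i) {i : Fin LO} (hi : i ∉ done) (hD : NO i ≤ D) :
    AllocInvariant T D M NB NO (insert i done) (allocStep D NO S i) := by
  have hn := h.n_pos
  have hk := fun e => linkSymbols_le (hNO i) hD hn h.con_nonneg (e := e)
  generalize hkd : linkSymbols D (NO i) S.n S.con = k at hk
  obtain ⟨c, hc, hdvd, hstep⟩ : ∃ c, 0 < c ∧ NO i ∣ c * S.n - c * k ∧ allocStep D NO S i =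
      { n := c * S.n
        kB := fun l => c * S.kB l
        kO := fun l => c * Function.update S.kO i k l
        con := moveNegatives fun d =>
          c * S.con d - optimalSpectrum (NO i) (c * S.n) (c * k) d } := by
    refine ⟨if NO i ∣ S.n - k then 1 else NO i, ?_, ?_, ?_⟩
    · split_ifs
      · exact one_pos
      · exact hNO i
    · split_ifs with hdiv
      · simpa using hdiv
      · rw [← Nat.mul_sub]
        exact Nat.dvd_mul_right _ _
    · rw [← hkd]
      rfl
  -- At `e = D + 1` the tail is empty, leaving the pure rate bound that limits codewords to `D + 1`
  -- time slots.
  have hlast := hk (D + 1) (by omega) le_rfl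
  simp only [Finset.Ico_self, Finset.sum_empty, mul_zero, add_zero] at hlast
  have hlt : k < S.n := by
    by_contra hge
    have h1 : (0 : ℤ) < NO i * S.n := by exact_mod_cast Nat.mul_pos (hNO i) hn
    have h2 : (S.n : ℤ) - k ≤ 0 := by omega
    have h3 := mul_nonpos_of_nonneg_of_nonpos (by positivity : (0 : ℤ) ≤ ((D + 1 : ℕ) : ℤ)) h2
    linarith
  have hpar : IsLinkParameter (D + 1) (NO i) (c * S.n) (c * k) := by
    refine ⟨Nat.mul_lt_mul_of_pos_left hlt hc, hdvd, ?_⟩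
    have h1 : NO i * S.n ≤ (D + 1) * (S.n - k) := by
      zify [hlt.le]
      exact_mod_cast hlast
    calc NO i * (c * S.n) = c * (NO i * S.n) := by ring
      _ ≤ c * ((D + 1) * (S.n - k)) := Nat.mul_le_mul_left c h1
      _ = (D + 1) * (c * S.n - c * k) := by rw [← Nat.mul_sub]; ring
  have hspec := sum_Ico_optimalSpectrum_le_con (con := fun d => c * S.con d) hpar (hNO i) hD
    (fun d => mul_nonneg (by positivity) (h.con_nonneg d)) (by
      intro e he heD
      have h1 := mul_le_mul_of_nonneg_left (hk e he heD) (by positivity : (0 : ℤ) ≤ c)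
      rw [← Finset.mul_sum]
      push_cast
      linarith)
  have hmove := sum_Ico_moveNegatives_le (e := D + 1)
    (v := fun d => c * S.con d - (optimalSpectrum (NO i) (c * S.n) (c * k) d : ℤ)) (by
      intro d
      rw [Finset.sum_sub_distrib]
      exact sub_nonneg.2 (hspec d))
  have hkO : ∀ j ∈ done, Function.update S.kO i k j = S.kO j := fun j hj =>
    Function.update_of_ne (ne_of_mem_of_not_mem hj hi) _ _
  rw [hstep]
  refine ⟨Nat.mul_pos hc hn, fun l => (h.bottleneck l).mul hc, ?_, fun d => le_max_left _ _, ?_⟩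
  · intro j hj
    rcases Finset.mem_insert.1 hj with rfl | hj
    · simpa using hpar
    · simpa only [hkO j hj] using (h.other j hj).mul hc
  · intro d
    have h1 := mul_le_mul_of_nonneg_left (h.sum_le d) (by positivity : (0 : ℤ) ≤ c)
    have h2 := hmove d
    have hO : ∑ j ∈ done, ∑ l ∈ Finset.Ico d (D + 1), (optimalSpectrum (NO j) (c * S.n)
        (c * Function.update S.kO i k j) l : ℤ) = c * ∑ j ∈ done, ∑ l ∈ Finset.Ico d (D + 1),
          (optimalSpectrum (NO j) S.n (S.kO j) l : ℤ) := by
      simp only [Finset.mul_sum]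
      refine Finset.sum_congr rfl fun j hj => Finset.sum_congr rfl fun l _ => ?_
      rw [hkO j hj, optimalSpectrum_mul (h.other j hj) (hNO j) hc]
      push_cast
      rfl
    have hB : ∑ l ∈ Finset.Ico d (D + 1), ∑ j, (optimalSpectrum (NB j) (c * S.n)
        (c * S.kB j) (T - l) : ℤ) = c * ∑ l ∈ Finset.Ico d (D + 1), ∑ j,
          (optimalSpectrum (NB j) S.n (S.kB j) (T - l) : ℤ) := by
      simp only [Finset.mul_sum]
      refine Finset.sum_congr rfl fun l _ => Finset.sum_congr rfl fun j _ => ?_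
      rw [optimalSpectrum_mul (h.bottleneck j) (hNB j) hc]
      push_cast
      rfl
    simp only [Finset.sum_insert hi, Function.update_self, hO, hB]
    rw [Finset.sum_sub_distrib, ← Finset.mul_sum] at h2
    linarith

theorem AllocInvariant.foldl {T D M LB LO : ℕ} {NB : Fin LB → ℕ} {NO : Fin LO → ℕ}
    (hNB : ∀ i, 0 < NB i) (hNO : ∀ i, 0 < NO i) (hD : ∀ i, NO i ≤ D) (order : List (Fin LO))
    (horder : order.Nodup) {done : Finset (Fin LO)} (hdone : ∀ i ∈ order, i ∉ done)
    {S : AllocState LB LO} (h : AllocInvariant T D M NB NO done S) :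
    AllocInvariant T D M NB NO (done ∪ order.toFinset) (order.foldl (allocStep D NO) S) := by
  induction order generalizing done S with
  | nil => simpa using h
  | cons i order ih =>
    rw [List.nodup_cons] at horder
    have hi : i ∉ done := hdone i List.mem_cons_self
    have := ih horder.2 (done := insert i done) (fun j hj hjd => by
      rcases Finset.mem_insert.1 hjd with rfl | hjd
      · exact horder.1 hj
      · exact hdone j (List.mem_cons_of_mem _ hj) hjd) (h.step hNB hNO hi (hD i))
    rwa [Finset.insert_union, ← Finset.union_insert, ← List.toFinset_cons] at this

/-- With `A = T + 1 - ⨅ j, NO j`, the rate bound `k / n ≤ (A - N) / A` is `N * n ≤ A * (n - k)`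
rearranged; the initial point attains equality. -/
theorem IsPointOfOperation.isLinkParameter {T LB LO : ℕ} {NB : Fin LB → ℕ} {NO : Fin LO → ℕ}
    {P : OperatingPoint LB} (hP : IsPointOfOperation T NB NO P) (hNB : ∀ i, 0 < NB i)
    (hT : ∀ i, NB i + ⨅ j, NO j ≤ T) (hmO : ⨅ j, NO j ≤ T) (hmB : ⨅ i, NB i ≤ T) :
    0 < P.n ∧ ∀ i, IsLinkParameter (T + 1 - ⨅ j, NO j) (NB i) P.n (P.k i) := by
  cases hP with
  | initial =>
    refine ⟨Nat.mul_pos (by omega) (by omega), fun i => ?_⟩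
    simp only [initialPoint]
    have h1 := hT i
    have h2 := hNB i
    generalize ⨅ j, NO j = mO at *
    generalize ⨅ i, NB i = mB at *
    have h3 : (T + 1 - mO) * (T + 1 - mB) - (T + 1 - mO - NB i) * (T + 1 - mB) =
        NB i * (T + 1 - mB) := by
      rw [← Nat.sub_mul]
      congr 1
      omega
    refine ⟨Nat.mul_lt_mul_of_pos_right (by omega) (by omega), ?_, ?_⟩
    · rw [h3]
      exact Nat.dvd_mul_right _ _
    · rw [h3]
      exact (Nat.mul_left_comm _ _ _).le
  | adjusted _ hn hrate hint =>
    refine ⟨hn, fun i => ?_⟩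
    have h1 := hrate i
    have h2 := hNB i
    have hcast : (T : ℚ) + 1 - (⨅ j, NO j : ℕ) = ((T + 1 - ⨅ j, NO j : ℕ) : ℚ) := by
      rw [Nat.cast_sub (by omega)]
      push_cast
      rfl
    have hA : 0 < T + 1 - ⨅ j, NO j := by omega
    rw [hcast] at h1
    generalize T + 1 - ⨅ j, NO j = A at *
    rw [div_le_div_iff₀ (by exact_mod_cast hn) (by exact_mod_cast hA)] at h1
    have h3 : (P.k i : ℤ) * A ≤ (A - NB i) * P.n := by exact_mod_cast h1
    have hlt : P.k i < P.n := by
      have h4 : (0 : ℤ) < NB i * P.n := by exact_mod_cast Nat.mul_pos h2 hn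
      have h5 : (P.k i : ℤ) * A < P.n * A := by linarith
      exact_mod_cast lt_of_mul_lt_mul_right h5 (by positivity)
    refine ⟨hlt, hint i, ?_⟩
    zify [hlt.le]
    linarith

theorem allocate_invariant {T LB LO : ℕ} {NB : Fin LB → ℕ} {NO : Fin LO → ℕ}
    (hNB : ∀ i, 0 < NB i) (hNO : ∀ j, 0 < NO j) (hT : ∀ i, NB i + ⨅ j, NO j ≤ T)
    (hT' : ∀ j, NO j + ⨅ i, NB i ≤ T) (hmO : ⨅ j, NO j ≤ T) (hmB : ⨅ i, NB i ≤ T)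
    {P : OperatingPoint LB} (hP : IsPointOfOperation T NB NO P) {order : List (Fin LO)}
    (horder : IsDecreasingOrder NO order) :
    AllocInvariant T (T - ⨅ i, NB i) (T + 1 - ⨅ j, NO j) NB NO Finset.univ
      (allocate T NB NO P order) := by
  obtain ⟨hn, hpar⟩ := hP.isLinkParameter hNB hT hmO hmB
  have hinit : AllocInvariant T (T - ⨅ i, NB i) (T + 1 - ⨅ j, NO j) NB NO ∅
      (allocInit T NB P) := by
    refine ⟨hn, hpar, by simp, fun d => ?_, fun d => ?_⟩
    · simp only [allocInit]
      positivity
    · simp [allocInit]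
  have huniv : (∅ ∪ order.toFinset : Finset (Fin LO)) = Finset.univ :=
    Finset.eq_univ_of_forall fun i => by simpa using horder.2.1 i
  have := hinit.foldl hNB hNO (fun j => by have := hT' j; omega) order horder.1 (by simp)
  rwa [huniv] at this

/-! ### Matching the delays of the two hops -/

/-- Match by rank, `f` decreasing against `g` increasing. A bad pair at rank `j` (from `0`) would
give at least `j + 1` elements with `f ≥ f a` but at most `j` compatible `b`, against the
hypothesis. Unmatched `b` have the last ranks, hence the largest `g`. -/
theorem exists_matching {α β : Type} [Fintype α] [Fintype β] (f : α → ℕ) (g : β → ℕ) (T : ℕ)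
    (h : ∀ d, (Finset.univ.filter fun a => d ≤ f a).card ≤
      (Finset.univ.filter fun b => g b + d ≤ T).card) :
    ∃ φ : α ↪ β, (∀ a, g (φ a) + f a ≤ T) ∧
      ∀ b, b ∉ Set.range φ → ∀ a, g (φ a) ≤ g b := by
  classical
  obtain ⟨eα, hα⟩ : ∃ e : Fin (Fintype.card α) ≃ α, Antitone (f ∘ e) :=
    ⟨(Tuple.sort (OrderDual.toDual ∘ f ∘ (Fintype.equivFin α).symm)).trans
      (Fintype.equivFin α).symm,
      Tuple.monotone_sort (OrderDual.toDual ∘ f ∘ (Fintype.equivFin α).symm)⟩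
  obtain ⟨eβ, hβ⟩ : ∃ e : Fin (Fintype.card β) ≃ β, Monotone (g ∘ e) :=
    ⟨(Tuple.sort (g ∘ (Fintype.equivFin β).symm)).trans (Fintype.equivFin β).symm,
      Tuple.monotone_sort (g ∘ (Fintype.equivFin β).symm)⟩
  have hcard : Fintype.card α ≤ Fintype.card β := by
    have h0 := h 0
    simp only [Nat.zero_le, Finset.filter_true, Finset.card_univ] at h0
    exact h0.trans (Finset.card_le_univ _)
  let φ : α ↪ β := (eα.symm.toEmbedding.trans (Fin.castLEEmb hcard)).trans eβ.toEmbedding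
  have hφ : ∀ a, φ a = eβ (Fin.castLE hcard (eα.symm a)) := fun _ => rfl
  refine ⟨φ, fun a => ?_, fun b hb a => ?_⟩
  · by_contra hlt
    set j := eα.symm a with hj
    have h1 : (Finset.Iic j).card ≤ (Finset.univ.filter fun x => f a ≤ f x).card := by
      refine Finset.card_le_card_of_injOn eα (fun x hx => ?_) eα.injective.injOn
      have := hα (Finset.mem_Iic.1 hx)
      simpa [hj] using this
    have h2 : (Finset.univ.filter fun b => g b + f a ≤ T).card ≤
        (Finset.Iio (Fin.castLE hcard j)).card := by
      refine Finset.card_le_card_of_injOn eβ.symm (fun x hx => ?_) eβ.symm.injective.injOn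
      rw [Finset.mem_coe, Finset.mem_Iio]
      by_contra hge
      have h3 := hβ (not_lt.1 hge)
      rw [hφ, ← hj] at hlt
      simp only [Function.comp_apply, Equiv.apply_symm_apply] at h3
      simp only [Finset.coe_filter, Finset.mem_univ, true_and, Set.mem_ofPred_eq] at hx
      omega
    have h3 := h (f a)
    rw [Fin.card_Iic] at h1
    rw [Fin.card_Iio, Fin.val_castLE] at h2
    omega
  · have hge : Fin.castLE hcard (eα.symm a) ≤ eβ.symm b := by
      by_contra hlt
      have hlt' : (eβ.symm b : ℕ) < Fintype.card α :=
        (Fin.lt_def.1 (not_le.1 hlt)).trans (eα.symm a).2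
      refine hb ⟨eα ⟨eβ.symm b, hlt'⟩, ?_⟩
      rw [hφ, Equiv.symm_apply_apply]
      exact (congrArg eβ (Fin.ext rfl)).trans (eβ.apply_symm_apply b)
    have := hβ hge
    simpa [hφ] using this

theorem card_filter_sigma {ι : Type} [Fintype ι] {κ : ι → Type} [∀ i, Fintype (κ i)]
    (p : (Σ i, κ i) → Prop) [DecidablePred p] :
    (Finset.univ.filter p).card = ∑ i, (Finset.univ.filter fun j => p ⟨i, j⟩).card := by
  simp only [Finset.card_filter, Fintype.sum_sigma]

theorem AllocInvariant.exists_hopDesign (F : Type*) [Field F] {T D M LB LO : ℕ}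
    {NB : Fin LB → ℕ} {NO : Fin LO → ℕ} {S : AllocState LB LO}
    (h : AllocInvariant T D M NB NO Finset.univ S) (hNB : ∀ i, 0 < NB i) (hNO : ∀ j, 0 < NO j)
    (hDT : D ≤ T) (hM : (M : ℕ∞) ≤ ENat.card F) (hD : ((D + 1 : ℕ) : ℕ∞) ≤ ENat.card F) :
    ∃ (HB : HopDesign F NB S.n (∑ j, S.kO j) S.kB) (HO : HopDesign F NO S.n (∑ j, S.kO j) S.kO),
      ∀ j, HB.symbolDelay j + HO.symbolDelay j ≤ T := by
  choose δB CB cardB achB intB using fun i => exists_linkCode F (h.bottleneck i) (hNB i) hM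
  choose δO CO cardO achO intO using
    fun j => exists_linkCode F (h.other j (Finset.mem_univ j)) (hNO j) hD
  obtain ⟨φ, hφ, hfree⟩ := exists_matching (α := Σ j, Fin (S.kO j)) (β := Σ i, Fin (S.kB i))
    (fun x => δO x.1 x.2) (fun x => δB x.1 x.2) T (by
      intro d
      rw [card_filter_sigma, card_filter_sigma]
      have hO : ∀ j, (Finset.univ.filter fun x => d ≤ δO j x).card =
          ∑ l ∈ Finset.Ico d (D + 1), optimalSpectrum (NO j) S.n (S.kO j) l := by
        intro j
        rw [Finset.card_eq_sum_card_fiberwise (f := δO j) (t := Finset.Ico d (D + 1))]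
        · refine Finset.sum_congr rfl fun l hl => ?_
          rw [← cardO, Finset.filter_filter]
          congr 1
          ext x
          simp only [Finset.mem_filter, Finset.mem_univ, true_and]
          have := (Finset.mem_Ico.1 hl).1
          omega
        · intro x hx
          simp only [Finset.coe_filter, Finset.mem_univ, true_and, Set.mem_ofPred_eq] at hx
          rw [Finset.mem_coe, Finset.mem_Ico]
          refine ⟨hx, ?_⟩
          by_contra hge
          have h1 := cardO j (δO j x)
          rw [optimalSpectrum_eq_zero (h.other j (Finset.mem_univ j)) (hNO j)
            (Or.inr (not_lt.1 hge)), Finset.card_eq_zero, Finset.filter_eq_empty_iff] at h1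
          exact h1 (Finset.mem_univ x) rfl
      have hB : ∀ i, ∑ l ∈ Finset.Ico d (D + 1), optimalSpectrum (NB i) S.n (S.kB i) (T - l) ≤
          (Finset.univ.filter fun x => δB i x + d ≤ T).card := by
        intro i
        simp only [← cardB]
        rw [← Finset.card_biUnion]
        · refine Finset.card_le_card fun x hx => ?_
          simp only [Finset.mem_biUnion, Finset.mem_Ico, Finset.mem_filter, Finset.mem_univ,
            true_and] at hx ⊢
          obtain ⟨l, hl, hx⟩ := hx
          omega
        · intro l hl l' hl' hne
          rw [Finset.mem_coe, Finset.mem_Ico] at hl hl'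
          -- As `l ≤ D ≤ T`, distinct `l` give distinct delays `T - l` without truncation.
          refine Finset.disjoint_filter.2 fun x _ h1 h2 => ?_
          omega
      have h1 := h.sum_le d
      have h2 : (0 : ℤ) ≤ ∑ l ∈ Finset.Ico d (D + 1), S.con l :=
        Finset.sum_nonneg fun l _ => h.con_nonneg l
      have h3 : ∑ j, ∑ l ∈ Finset.Ico d (D + 1), optimalSpectrum (NO j) S.n (S.kO j) l ≤
          ∑ l ∈ Finset.Ico d (D + 1), ∑ i, optimalSpectrum (NB i) S.n (S.kB i) (T - l) := by
        zify
        linarith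
      rw [Finset.sum_comm (s := Finset.Ico d (D + 1))] at h3
      simp only [hO]
      exact h3.trans (Finset.sum_le_sum fun i _ => hB i))
  -- Source symbols are identified with all positions of hop `O`, so only hop `B` can have free
  -- ones.
  let e : Fin (∑ j, S.kO j) ≃ Σ j, Fin (S.kO j) := finSigmaFinEquiv.symm
  refine ⟨⟨δB, CB, e.toEmbedding.trans φ, cardB, achB, intB, ?_⟩,
    ⟨δO, CO, e.toEmbedding, cardO, achO, intO, ?_⟩, fun j => hφ (e j)⟩
  · intro x hx j
    refine hfree x ?_ (e j)
    rintro ⟨a, rfl⟩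
    exact hx ⟨e.symm a, by simp⟩
  · intro x hx
    exact absurd ⟨e.symm x, by simp⟩ hx

theorem exists_hopDesign_allocate (F : Type*) [Field F] {T LB LO : ℕ} {NB : Fin LB → ℕ}
    {NO : Fin LO → ℕ} (hLB : 0 < LB) (hLO : 0 < LO) (hNB : ∀ i, 0 < NB i) (hNO : ∀ j, 0 < NO j)
    (hT : ∀ i, NB i + ⨅ j, NO j ≤ T) (hT' : ∀ j, NO j + ⨅ i, NB i ≤ T)
    (hF : (T : ℕ∞) ≤ ENat.card F) {P : OperatingPoint LB} (hP : IsPointOfOperation T NB NO P)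
    {order : List (Fin LO)} (horder : IsDecreasingOrder NO order) :
    ∃ (HB : HopDesign F NB (allocate T NB NO P order).n (∑ j, (allocate T NB NO P order).kO j)
        (allocate T NB NO P order).kB)
      (HO : HopDesign F NO (allocate T NB NO P order).n (∑ j, (allocate T NB NO P order).kO j)
        (allocate T NB NO P order).kO),
      ∀ j, HB.symbolDelay j + HO.symbolDelay j ≤ T := by
  have : Nonempty (Fin LB) := ⟨⟨0, hLB⟩⟩
  have : Nonempty (Fin LO) := ⟨⟨0, hLO⟩⟩
  have hmO : 0 < ⨅ j, NO j := by
    obtain ⟨j, hj⟩ := ciInf_mem NO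
    exact hj ▸ hNO j
  have hmB : 0 < ⨅ i, NB i := by
    obtain ⟨i, hi⟩ := ciInf_mem NB
    exact hi ▸ hNB i
  have h1 := hT ⟨0, hLB⟩
  have h2 := hT' ⟨0, hLO⟩
  refine (allocate_invariant hNB hNO hT hT' (by omega) (by omega) hP horder).exists_hopDesign F
    hNB hNO (Nat.sub_le _ _) (le_trans ?_ hF) (le_trans ?_ hF)
  -- Both minima are at least `1`, so all codewords have length at most `T` and `T` field elements
  -- suffice.
  · exact_mod_cast (by omega : T + 1 - ⨅ j, NO j ≤ T)
  · exact_mod_cast (by omega : T - (⨅ i, NB i) + 1 ≤ T)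

end MultiLinkRelay

theorem mainTheorem1 (F : Type*) [Field F] (T : ℕ) {L₁ L₂ : ℕ} (hL₁ : 0 < L₁) (hL₂ : 0 < L₂)
    (N₁ : Fin L₁ → ℕ) (N₂ : Fin L₂ → ℕ) (hN₁ : ∀ i, 0 < N₁ i) (hN₂ : ∀ j, 0 < N₂ j)
    (hT₁ : ∀ i, N₁ i + ⨅ j, N₂ j ≤ T) (hT₂ : ∀ j, N₂ j + ⨅ i, N₁ i ≤ T)
    (hF : (T : ℕ∞) ≤ ENat.card F) :
    (∀ (P : MultiLinkRelay.OperatingPoint L₁) (order : List (Fin L₂)),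
      MultiLinkRelay.IsPointOfOperation T N₁ N₂ P →
      MultiLinkRelay.IsDecreasingOrder N₂ order →
      MultiLinkRelay.SchemeAchieves F T N₁ N₂
        (MultiLinkRelay.allocate T N₁ N₂ P order).n
        (∑ j, (MultiLinkRelay.allocate T N₁ N₂ P order).kO j)
        (MultiLinkRelay.allocate T N₁ N₂ P order).kB
        (MultiLinkRelay.allocate T N₁ N₂ P order).kO) ∧
    (∀ (P : MultiLinkRelay.OperatingPoint L₂) (order : List (Fin L₁)),
      MultiLinkRelay.IsPointOfOperation T N₂ N₁ P →
      MultiLinkRelay.IsDecreasingOrder N₁ order →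
      MultiLinkRelay.SchemeAchieves F T N₁ N₂
        (MultiLinkRelay.allocate T N₂ N₁ P order).n
        (∑ i, (MultiLinkRelay.allocate T N₂ N₁ P order).kO i)
        (MultiLinkRelay.allocate T N₂ N₁ P order).kO
        (MultiLinkRelay.allocate T N₂ N₁ P order).kB) := by
  refine ⟨fun P order hP horder => ?_, fun P order hP horder => ?_⟩
  · obtain ⟨H₁, H₂, hT⟩ := MultiLinkRelay.exists_hopDesign_allocate F hL₁ hL₂ hN₁ hN₂ hT₁ hT₂ hF
      hP horder
    exact ⟨H₁, H₂, hT, MultiLinkRelay.symbolwiseDF_isAchievable hT H₁.hopCode_achieves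
      H₂.hopCode_achieves⟩
  -- The delay budget is symmetric in the hops, so the same construction serves a bottleneck in the
  -- second hop.
  · obtain ⟨H₂, H₁, hT⟩ := MultiLinkRelay.exists_hopDesign_allocate F hL₂ hL₁ hN₂ hN₁ hT₂ hT₁ hF
      hP horder
    have hT' : ∀ j, H₁.symbolDelay j + H₂.symbolDelay j ≤ T := fun j => by
      rw [add_comm]
      exact hT j
    exact ⟨H₁, H₂, hT', MultiLinkRelay.symbolwiseDF_isAchievable hT' H₁.hopCode_achieves
      H₂.hopCode_achieves⟩
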